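/- **Theorem.** For integers $n\ge 1$ and real $q$, let $\mathrm{MK}(q)$ be the unweighted minimum knapsack problem: minimize $|\mathbf x|:=x_1+\dots+x_n$ subject to $|\mathbf x|\ge q$, $\mathbf x\in\{0,1\}^n$. For $d\in\mathbb Z_{\ge 0}$, the degree-$d$ SOS program of $\mathrm{MK}(q)$ is to maximize $\lambda\in\mathbb R$ subject to the existence of sums of squares $s_0,s_1\in\mathbb R[x_1,\dots,x_n]$ with $\deg s_0\le 2d+2$, $\deg s_1\le 2d$ and $$|\mathbf x|-\lambda=s_0(\mathbf x)+s_1(\mathbf x)\,(|\mathbf x|-q)\qquad\text{for all }\mathbf x\in\{0,1\}^n .$$ The program is exact if its maximum is attained and equals the optimal value of $\mathrm{MK}(q)$, and the SOS rank $\mathrm{SOS}_{\mathrm{rk}}(\mathrm{MK}(q))$ is the smallest $d$ for which the degree-$d$ program is exact. Write $\widehat q=q-\lfloor q\rfloor$ for the fractional part of $q$. There is an absolute constant $c>0$ such that for all $n$ and all real $q$ with $0<q<\lfloor n/2\rfloor$ and $\widehat q\neq 0$, $$\mathrm{SOS}_{\mathrm{rk}}(\mathrm{MK}(q))\ \ge\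 \begin{cases} c\,\min\bigl\{n,\ \sqrt{n\log(1/\widehat q)}\bigr\} & \text{if } 0<\widehat q\le 1/2,\\[4pt] c\,\sqrt{n(1-\widehat q)} & \text{if } 1/2<\widehat q<1.\end{cases}$$ -/

import Mathlib

open MvPolynomial

/-- The Boolean hypercube `{0,1}^n`, as a set of points of `ℝ^n`. -/
def boolCube (n : ℕ) : Set (Fin n → ℝ) := {x | ∀ i, x i = 0 ∨ x i = 1}

/-- The Hamming weight `|x| = x_1 + ⋯ + x_n`. -/
def hammingWt {n : ℕ} (x : Fin n → ℝ) : ℝ := ∑ i, x i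

/-- The objective values attained by the feasible points of the unweighted minimum knapsack
problem `MK(q)`: minimize `|x|` subject to `|x| ≥ q` and `x ∈ {0,1}^n`. -/
def mkValues (n : ℕ) (q : ℝ) : Set ℝ :=
  hammingWt '' {x | x ∈ boolCube n ∧ q ≤ hammingWt x}

/-- `v` is the optimal value of `MK(q)`. -/
def IsMKOptimum (n : ℕ) (q v : ℝ) : Prop := IsLeast (mkValues n q) v

/-- A degree-`d` SOS certificate for the lower bound `lam` on `MK(q)`: real polynomials `s₀`, `s₁`
that are sums of squares, with `deg s₀ ≤ 2d + 2` and `deg s₁ ≤ 2d`, such that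
`|x| - lam = s₀(x) + s₁(x) (|x| - q)` on the hypercube. -/
structure IsSOSCertificate {n : ℕ} (q : ℝ) (d : ℕ) (lam : ℝ)
    (s₀ s₁ : MvPolynomial (Fin n) ℝ) : Prop where
  sos₀ : IsSumSq s₀
  sos₁ : IsSumSq s₁
  degree₀ : s₀.totalDegree ≤ 2 * d + 2
  degree₁ : s₁.totalDegree ≤ 2 * d
  identity : ∀ x ∈ boolCube n,
    hammingWt x - lam = eval x s₀ + eval x s₁ * (hammingWt x - q)

/-- The feasible values of the degree-`d` SOS program of `MK(q)`. -/
def sosValues (n : ℕ) (q : ℝ) (d : ℕ) : Set ℝ :=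
  {lam | ∃ s₀ s₁ : MvPolynomial (Fin n) ℝ, IsSOSCertificate q d lam s₀ s₁}

/-- The degree-`d` SOS program of `MK(q)` is exact: its maximum is the optimal value of `MK(q)`. -/
def SOSExact (n : ℕ) (q : ℝ) (d : ℕ) : Prop :=
  ∃ v, IsMKOptimum n q v ∧ IsGreatest (sosValues n q d) v

/-- The SOS rank of `MK(q)`: the smallest `d` for which the degree-`d` SOS program is exact.
By `sosExact_self` below such a `d` exists whenever `q ≤ n`. -/
noncomputable def sosRank (n : ℕ) (q : ℝ) : ℕ := sInf {d | SOSExact n q d}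

/-- The point of the hypercube with support `S`. -/
def cubePoint {n : ℕ} (S : Finset (Fin n)) : Fin n → ℝ := fun i => if i ∈ S then 1 else 0

theorem hammingWt_cubePoint {n : ℕ} (S : Finset (Fin n)) :
    hammingWt (cubePoint S) = S.card := by
  simp [hammingWt, cubePoint]

theorem cubePoint_mem {n : ℕ} (S : Finset (Fin n)) : cubePoint S ∈ boolCube n := by
  intro i
  by_cases h : i ∈ S <;> simp [cubePoint, h]

theorem exists_cubePoint {n : ℕ} {x : Fin n → ℝ} (hx : x ∈ boolCube n) :
    ∃ S, x = cubePoint S := by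
  classical
  refine ⟨Finset.univ.filter (fun i => x i = 1), funext fun i => ?_⟩
  rcases hx i with h | h <;> simp [cubePoint, h]

/-- For `q ≤ n` the optimal value of `MK(q)` is `⌈q⌉`, or `0` if `q` is negative. -/
theorem isMKOptimum_ceil {n : ℕ} {q : ℝ} (hn : q ≤ n) :
    IsMKOptimum n q (⌈q⌉₊ : ℝ) := by
  constructor
  · obtain ⟨S, -, hS⟩ := Finset.exists_subset_card_eq
      (s := (Finset.univ : Finset (Fin n))) (n := ⌈q⌉₊) (by simpa using Nat.ceil_le.2 hn)
    refine ⟨cubePoint S, ⟨cubePoint_mem S, ?_⟩, ?_⟩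
    · rw [hammingWt_cubePoint, hS]; exact Nat.le_ceil q
    · rw [hammingWt_cubePoint, hS]
  · rintro _ ⟨x, ⟨hx, hq⟩, rfl⟩
    obtain ⟨S, rfl⟩ := exists_cubePoint hx
    rw [hammingWt_cubePoint] at hq ⊢
    exact_mod_cast Nat.ceil_le.2 hq

theorem eval_nonneg_of_isSumSq {n : ℕ} {s : MvPolynomial (Fin n) ℝ} (hs : IsSumSq s)
    (x : Fin n → ℝ) : 0 ≤ eval x s := by
  induction hs with
  | zero => simp
  | sq_add a _ ih => rw [map_add, map_mul]; exact add_nonneg (mul_self_nonneg _) ih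

/-- The optimal value bounds every SOS value from above. -/
theorem sosValues_le {n : ℕ} {q v lam : ℝ} {d : ℕ} (hv : IsMKOptimum n q v)
    (hlam : lam ∈ sosValues n q d) : lam ≤ v := by
  obtain ⟨⟨x, ⟨hx, hq⟩, rfl⟩, -⟩ := hv
  obtain ⟨s₀, s₁, h⟩ := hlam
  have h0 : 0 ≤ eval x s₀ := eval_nonneg_of_isSumSq h.sos₀ x
  have h1 : 0 ≤ eval x s₁ := eval_nonneg_of_isSumSq h.sos₁ x
  have := h.identity x hx
  nlinarith [mul_nonneg h1 (sub_nonneg.2 hq)]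

/-- A nonnegative function on the hypercube is given by a sum of squares of degree at most `2n`. -/
theorem exists_sumSq_interpolant {n : ℕ} (F : Finset (Fin n) → ℝ) (hF : ∀ S, 0 ≤ F S) :
    ∃ s : MvPolynomial (Fin n) ℝ, IsSumSq s ∧ s.totalDegree ≤ 2 * n ∧
      ∀ S, eval (cubePoint S) s = F S := by
  classical
  let δ : Finset (Fin n) → MvPolynomial (Fin n) ℝ := fun S =>
    ∏ i, if i ∈ S then X i else 1 - X i
  have hdeg : ∀ S, (δ S).totalDegree ≤ n := by
    intro S
    refine (totalDegree_finsetProd _ _).trans ?_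
    refine (Finset.sum_le_card_nsmul _ _ 1 fun i _ => ?_).trans (by simp)
    split_ifs
    · simp
    · exact (totalDegree_sub _ _).trans (by simp)
  have hev : ∀ S T, eval (cubePoint T) (δ S) = if S = T then 1 else 0 := by
    intro S T
    simp only [δ, map_prod]
    split_ifs with h
    · subst h
      refine Finset.prod_eq_one fun i _ => ?_
      by_cases hi : i ∈ S <;> simp [cubePoint, hi]
    · have : ∃ i, ¬(i ∈ S ↔ i ∈ T) := by
        by_contra hc
        push Not at hc
        exact h (Finset.ext hc)
      obtain ⟨i, hi⟩ := this
      refine Finset.prod_eq_zero (Finset.mem_univ i) ?_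
      by_cases h1 : i ∈ S <;> by_cases h2 : i ∈ T <;> simp_all [cubePoint]
  refine ⟨∑ S, (C (√(F S)) * δ S) * (C (√(F S)) * δ S), ?_, ?_, ?_⟩
  · exact IsSumSq.sum fun S _ => IsSumSq.mul_self _
  · refine (totalDegree_finsetSum _ _).trans (Finset.sup_le fun S _ => ?_)
    have h1 : (C (√(F S)) * δ S).totalDegree ≤ n :=
      (totalDegree_mul _ _).trans (by simpa using hdeg S)
    exact (totalDegree_mul _ _).trans (by omega)
  · intro T
    have key : ∀ S, √(F S) * (if S = T then (1 : ℝ) else 0) * (√(F S) * (if S = T then 1 else 0))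
        = if S = T then F S else 0 := by
      intro S
      split_ifs
      · simpa using Real.mul_self_sqrt (hF S)
      · simp
    simp only [map_sum, map_mul, eval_C, hev, key]
    simp

/-- The degree-`n` SOS program is exact, so the SOS rank is a genuine minimum. -/
theorem sosExact_self {n : ℕ} {q : ℝ} (hn : q ≤ n) : SOSExact n q n := by
  classical
  have hopt := isMKOptimum_ceil hn
  refine ⟨_, hopt, ?_, fun lam h => sosValues_le hopt h⟩
  have hc : ∀ k : ℕ, q ≤ k → (⌈q⌉₊ : ℝ) ≤ k := fun k hk => by exact_mod_cast Nat.ceil_le.2 hk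
  have hq := Nat.le_ceil q
  let F : Finset (Fin n) → ℝ := fun S =>
    if (S.card : ℝ) < q then ((⌈q⌉₊ : ℝ) - S.card) / (q - S.card) else 0
  obtain ⟨s₁, hs₁, hd₁, he₁⟩ := exists_sumSq_interpolant F (fun S => by
    simp only [F]
    split_ifs with h
    · exact div_nonneg (by linarith) (by linarith)
    · exact le_rfl)
  obtain ⟨s₀, hs₀, hd₀, he₀⟩ := exists_sumSq_interpolant
    (fun S : Finset (Fin n) => (S.card : ℝ) - ⌈q⌉₊ - F S * (S.card - q)) (fun S => by
      simp only [F]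
      split_ifs with h
      · have : q - (S.card : ℝ) ≠ 0 := by linarith
        have e : ((⌈q⌉₊ : ℝ) - S.card) / (q - S.card) * (S.card - q) = S.card - ⌈q⌉₊ := by
          field_simp
          ring
        rw [e]; simp
      · have := hc _ (not_lt.1 h)
        simp only [zero_mul, sub_zero]
        linarith)
  refine ⟨s₀, s₁, hs₀, hs₁, by omega, hd₁, fun x hx => ?_⟩
  obtain ⟨S, rfl⟩ := exists_cubePoint hx
  rw [he₀, he₁, hammingWt_cubePoint]
  ring

/-! Write q = a + θ and suppose degree d certifies the optimum a + 1. The identity forces s₁ ≥ 1/θ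
on level a, s₁ = 0 on level a + 1 and 0 ≤ s₁ ≤ 1 above. Averaging s₁ over levels gives a univariate
p of degree at most 2d with p(0) ≥ 1/θ > 1, p(1) = 0 and 0 ≤ p ≤ 1 on 1, …, N, where N = n - a ≥
n/2.

Such a jump at 0 needs high degree, because p(0) can be extrapolated from integer nodes with small
weights. The nodes 1 and 9i² are exact to degree D with total weight at most 1/2 off the node 1, so
p(1) = 0 forces N < 36d² (`lt_nine_mul_sq_of_half_lt_eval_zero`). This settles θ > 1/2.

For small θ the functional is iterated: subtracting from p its translated extrapolation lowers the
degree by D + 1 and at most triples the bound (`abs_eval_zero_le_of_functional`). After M rounds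
|p(0)| < 3^M; taking M of order log(1/θ) and D of order √(N/M) gives d of order √(NM). -/

/-! ### Symmetrization -/

/-- Averaging a polynomial over the levels of the hypercube gives a univariate polynomial. -/
theorem exists_polynomial_eval_eq_average {n : ℕ} (s : MvPolynomial (Fin n) ℝ) :
    ∃ P : Polynomial ℝ, P.natDegree ≤ s.totalDegree ∧ ∀ j : ℕ, j ≤ n →
      P.eval (j : ℝ) =
        (∑ S ∈ (Finset.univ : Finset (Fin n)).powersetCard j, eval (cubePoint S) s) /
          (n.choose j : ℝ) := by
  classical
  -- On the cube a monomial with k variables is the indicator of its support; its mean over level j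
  -- is the ratio of falling factorials (j)ₖ / (n)ₖ.
  refine ⟨∑ m ∈ s.support, Polynomial.C (s.coeff m / (n.descFactorial m.support.card : ℝ)) *
    descPochhammer ℝ m.support.card, ?_, ?_⟩
  · refine Polynomial.natDegree_sum_le_of_forall_le _ _ fun m hm => ?_
    refine (Polynomial.natDegree_C_mul_le _ _).trans ?_
    rw [descPochhammer_natDegree]
    refine le_trans ?_ (le_totalDegree hm)
    rw [Finsupp.sum, Finset.card_eq_sum_ones]
    exact Finset.sum_le_sum fun i hi => Nat.one_le_iff_ne_zero.2 (Finsupp.mem_support_iff.1 hi)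
  · intro j hj
    have hev : ∀ S : Finset (Fin n), eval (cubePoint S) s =
        ∑ m ∈ s.support, s.coeff m * if m.support ⊆ S then 1 else 0 := by
      intro S
      rw [eval_eq]
      refine Finset.sum_congr rfl fun m _ => ?_
      congr 1
      split_ifs with h
      · exact Finset.prod_eq_one fun i hi => by simp [cubePoint, h hi]
      · obtain ⟨i, hi, hiS⟩ := Finset.not_subset.1 h
        refine Finset.prod_eq_zero hi ?_
        simp [cubePoint, hiS, Finsupp.mem_support_iff.1 hi]
    simp only [hev]
    rw [Finset.sum_comm, Finset.sum_div, Polynomial.eval_finsetSum]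
    refine Finset.sum_congr rfl fun m _ => ?_
    rw [Polynomial.eval_mul, Polynomial.eval_C, descPochhammer_eval_eq_descFactorial,
      ← Finset.mul_sum, div_mul_eq_mul_div, mul_div_assoc, mul_div_assoc]
    congr 1
    have hcard : m.support.card ≤ n := by simpa using Finset.card_le_univ m.support
    rw [Finset.sum_ite, Finset.sum_const_zero, add_zero, Finset.sum_const, nsmul_one]
    have hn0 : (n.choose j : ℝ) ≠ 0 := by exact_mod_cast (Nat.choose_pos hj).ne'
    have hd0 : (n.descFactorial m.support.card : ℝ) ≠ 0 := by
      exact_mod_cast (Nat.descFactorial_pos.2 hcard).ne'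
    rw [div_eq_div_iff hd0 hn0]
    rcases le_or_gt m.support.card j with h | h
    · have hc : (Finset.filter (fun S => m.support ⊆ S)
          ((Finset.univ : Finset (Fin n)).powersetCard j)).card
          = (n - m.support.card).choose (j - m.support.card) := by
        simpa using Finset.card_filter_powersetCard_subset m.support Finset.univ j
          (Finset.subset_univ _) h
      rw [hc]
      have h1 := Nat.choose_mul (n := n) h
      have h2 := Nat.descFactorial_eq_factorial_mul_choose j m.support.card
      have h3 := Nat.descFactorial_eq_factorial_mul_choose n m.support.card
      rw [h2, h3]
      norm_cast
      linear_combination (m.support.card).factorial * h1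
    · have h0 : Finset.filter (fun S => m.support ⊆ S)
          ((Finset.univ : Finset (Fin n)).powersetCard j) = ∅ := by
        refine Finset.filter_eq_empty_iff.2 fun S hS hsub => ?_
        have := Finset.card_le_card hsub
        rw [(Finset.mem_powersetCard.1 hS).2] at this
        omega
      rw [h0, Nat.descFactorial_of_lt h]
      simp

/-! ### Extrapolation to 0 from integer nodes -/

theorem sum_range_inv_succ_sq_le (D : ℕ) : ∑ i ∈ Finset.range D, 1 / ((i : ℝ) + 1) ^ 2 ≤ 2 := by
  have h := sum_Ioo_inv_sq_le (α := ℝ) 0 (D + 1)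
  have e : Finset.Ioo 0 (D + 1) = Finset.Ico 1 (D + 1) := by ext; simp; omega
  rw [e, Finset.sum_Ico_eq_sum_range] at h
  simpa [add_comm] using h

/-- The central finite difference of order `2 * D` applied to `t ↦ g (9 * t ^ 2)`. -/
theorem eval_zero_eq_sum_of_natDegree_lt {D : ℕ} {g : Polynomial ℝ} (hg : g.natDegree < D) :
    g.eval 0 = ∑ i ∈ Finset.range D,
      -((-1) ^ (i + 1) * (2 * ((2 * D).choose (D + (i + 1)) : ℝ) / ((2 * D).choose D : ℝ))) *
        g.eval (9 * ((i : ℝ) + 1) ^ 2) := by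
  have hdeg : (g.comp (Polynomial.C 9 * Polynomial.X ^ 2)).natDegree < 2 * D := by
    have h1 : (g.comp (Polynomial.C (9 : ℝ) * Polynomial.X ^ 2)).natDegree ≤ g.natDegree * 2 :=
      Polynomial.natDegree_comp_le.trans
        (Nat.mul_le_mul_left _ (Polynomial.natDegree_C_mul_X_pow_le _ _))
    omega
  have h := congrFun (Polynomial.fwdDiff_iter_eq_zero_of_degree_lt hdeg) (-(D : ℝ))
  rw [fwdDiff_iter_eq_sum_shift] at h
  have e : 2 * D + 1 = D + (D + 1) := by ring
  -- The difference is centred at 0, so the nodes t and -t pair up and evenness doubles their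
  -- weight.
  rw [e, Finset.sum_range_add, Finset.sum_range_succ', ← Finset.sum_range_reflect,
    ← add_assoc, ← Finset.sum_add_distrib] at h
  have hc : ((2 * D).choose D : ℝ) ≠ 0 := by
    exact_mod_cast (Nat.choose_pos (by omega)).ne'
  have key : ∑ i ∈ Finset.range D, (-1) ^ D * ((-1) ^ (i + 1) *
      (2 * ((2 * D).choose (D + (i + 1)) : ℝ)) * g.eval (9 * ((i : ℝ) + 1) ^ 2)) +
      (-1) ^ D * (((2 * D).choose D : ℝ) * g.eval 0) = 0 := by
    refine Eq.trans ?_ h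
    congr 1
    · refine Finset.sum_congr rfl fun i hi => ?_
      have hi' := Finset.mem_range.1 hi
      obtain ⟨b, hb⟩ : ∃ b, D = i + 1 + b := ⟨D - (i + 1), by omega⟩
      have e1 : D - 1 - i = b := by omega
      have e2 : 2 * D - b = D + (i + 1) := by omega
      have e3 : 2 * D - (D + (i + 1)) = b := by omega
      have e4 : (2 * D).choose b = (2 * D).choose (D + (i + 1)) := by
        rw [← e2, Nat.choose_symm (by omega)]
      have e5 : (-1 : ℝ) ^ b = (-1) ^ D * (-1) ^ (i + 1) := by
        rw [hb, ← pow_add, show i + 1 + b + (i + 1) = 2 * (i + 1) + b by ring, pow_add, pow_mul]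
        simp
      have e6 : (-1 : ℝ) ^ (D + (i + 1)) = (-1) ^ D * (-1) ^ (i + 1) := pow_add _ _ _
      have e7 : -(D : ℝ) + b = -((i : ℝ) + 1) := by rw [hb]; push_cast; ring
      rw [e1, e2, e3, e4]
      simp only [zsmul_eq_mul, nsmul_eq_mul, mul_one, Polynomial.eval_comp, Polynomial.eval_mul,
        Polynomial.eval_C, Polynomial.eval_pow, Polynomial.eval_X]
      push_cast
      rw [e5, e6, e7, show -(D : ℝ) + (D + (i + 1)) = i + 1 by ring, neg_sq]
      ring
    · have e3 : 2 * D - D = D := by omega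
      simp [e3, mul_assoc]
  rw [← Finset.mul_sum, ← mul_add] at key
  have key' := (mul_eq_zero.1 key).resolve_left (pow_ne_zero _ (by norm_num))
  have e8 : ∑ i ∈ Finset.range D,
      -((-1) ^ (i + 1) * (2 * ((2 * D).choose (D + (i + 1)) : ℝ) / ((2 * D).choose D : ℝ))) *
        g.eval (9 * ((i : ℝ) + 1) ^ 2) = -(∑ i ∈ Finset.range D, (-1) ^ (i + 1) *
      (2 * ((2 * D).choose (D + (i + 1)) : ℝ)) * g.eval (9 * ((i : ℝ) + 1) ^ 2)) /
      ((2 * D).choose D : ℝ) := by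
    rw [← Finset.sum_neg_distrib, Finset.sum_div]
    exact Finset.sum_congr rfl fun i _ => by ring
  rw [e8, eq_div_iff hc]
  linear_combination key'

/-- Extrapolation to `0` from the nodes `1` and `9 * i ^ 2`, exact up to degree `D`. -/
theorem exists_extrapolation_weights (D : ℕ) :
    ∃ u : ℕ → ℝ, ∑ i ∈ Finset.range D, |u i| ≤ 1 / 2 ∧
      ∀ p : Polynomial ℝ, p.natDegree ≤ D → p.eval 0 = p.eval 1 +
        ∑ i ∈ Finset.range D, u i * (p.eval (9 * ((i : ℝ) + 1) ^ 2) - p.eval 1) := by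
  -- The difference formula is applied to g = (p - p(1))/(X - 1). Dividing by 1 - 9s, with s = (i +
  -- 1)², leaves a weight of at most 2/(9s - 1) ≤ 1/(4s), whence the total 1/2.
  refine ⟨fun i => -((-1) ^ (i + 1) * (2 * ((2 * D).choose (D + (i + 1)) : ℝ) /
    ((2 * D).choose D : ℝ))) / (1 - 9 * ((i : ℝ) + 1) ^ 2), ?_, fun p hp => ?_⟩
  · have hc : (0 : ℝ) < ((2 * D).choose D : ℝ) := by
      exact_mod_cast Nat.choose_pos (by omega)
    have hb : ∀ i ∈ Finset.range D, |-((-1) ^ (i + 1) * (2 * ((2 * D).choose (D + (i + 1)) : ℝ) /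
        ((2 * D).choose D : ℝ))) / (1 - 9 * ((i : ℝ) + 1) ^ 2)| ≤
        1 / 4 * (1 / ((i : ℝ) + 1) ^ 2) := by
      intro i _
      have h1 : ((2 * D).choose (D + (i + 1)) : ℝ) ≤ ((2 * D).choose D : ℝ) := by
        exact_mod_cast Nat.choose_le_centralBinom _ _
      have h2 : (1 : ℝ) ≤ ((i : ℝ) + 1) ^ 2 := one_le_pow₀ (by linarith [Nat.cast_nonneg (α := ℝ) i])
      rw [abs_div, abs_neg, abs_mul, abs_pow, abs_neg, abs_one, one_pow, one_mul,
        abs_of_nonneg (by positivity), abs_of_neg (by linarith), div_le_iff₀ (by linarith)]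
      have h3 : 2 * ((2 * D).choose (D + (i + 1)) : ℝ) / ((2 * D).choose D : ℝ) ≤ 2 := by
        rw [div_le_iff₀ hc]; linarith
      refine h3.trans ?_
      rw [mul_one_div, div_mul_eq_mul_div, le_div_iff₀ (by linarith)]
      linarith
    refine (Finset.sum_le_sum hb).trans ?_
    rw [← Finset.mul_sum]
    linarith [sum_range_inv_succ_sq_le D]
  · rcases Nat.eq_zero_or_pos D with rfl | hD
    · rw [Polynomial.eq_C_of_natDegree_le_zero hp]; simp
    obtain ⟨g, hg⟩ : (Polynomial.X - Polynomial.C 1 : Polynomial ℝ) ∣ p - Polynomial.C (p.eval 1) :=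
      Polynomial.X_sub_C_dvd_sub_C_eval
    have hgd : g.natDegree < D := by
      by_cases h0 : g = 0
      · simpa [h0] using hD
      have h1 : (p - Polynomial.C (p.eval 1)).natDegree ≤ D := by simpa using hp
      rw [hg, Polynomial.natDegree_mul (Polynomial.X_sub_C_ne_zero 1) h0,
        Polynomial.natDegree_X_sub_C] at h1
      omega
    have hev : ∀ t, p.eval t - p.eval 1 = (t - 1) * g.eval t := by
      intro t
      simpa using congrArg (Polynomial.eval t) hg
    have h0 := eval_zero_eq_sum_of_natDegree_lt hgd
    have h1 : p.eval 0 = p.eval 1 - g.eval 0 := by linear_combination hev 0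
    rw [h1, h0, sub_eq_add_neg, ← Finset.sum_neg_distrib]
    congr 1
    refine Finset.sum_congr rfl fun i _ => ?_
    have h2 : (1 : ℝ) ≤ ((i : ℝ) + 1) ^ 2 := one_le_pow₀ (by linarith [Nat.cast_nonneg (α := ℝ) i])
    have h3 : (1 - 9 * ((i : ℝ) + 1) ^ 2) ≠ 0 := by linarith
    rw [hev, div_mul_eq_mul_div, eq_div_iff h3]
    ring

/-- Collecting the p(1) terms gives the node 1 weight 1 - ∑ u, so the total is at most 1 + 2 ·
(1/2). -/
theorem exists_extrapolation_functional {D : ℕ} (hD : 1 ≤ D) :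
    ∃ (v : ℕ → ℝ) (ν : ℕ → ℕ), (∀ i ∈ Finset.range (D + 1), 1 ≤ ν i ∧ ν i ≤ 9 * D ^ 2) ∧
      ∑ i ∈ Finset.range (D + 1), |v i| ≤ 2 ∧
      ∀ p : Polynomial ℝ, p.natDegree ≤ D →
        p.eval 0 = ∑ i ∈ Finset.range (D + 1), v i * p.eval (ν i : ℝ) := by
  obtain ⟨u, hu, hp⟩ := exists_extrapolation_weights D
  refine ⟨fun i => Nat.casesOn i (1 - ∑ i ∈ Finset.range D, u i) u,
    fun i => Nat.casesOn i 1 fun j => 9 * (j + 1) ^ 2, ?_, ?_, fun p hpD => ?_⟩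
  · rintro (_ | i) hi
    · have : 1 ≤ D ^ 2 := Nat.one_le_pow _ _ hD
      exact ⟨le_rfl, by show 1 ≤ _; omega⟩
    · have h1 : i + 1 ≤ D := by have := Finset.mem_range.1 hi; omega
      have h2 : (i + 1) ^ 2 ≤ D ^ 2 := Nat.pow_le_pow_left h1 2
      have h3 : 1 ≤ (i + 1) ^ 2 := Nat.one_le_pow _ _ (by omega)
      exact ⟨by show 1 ≤ 9 * (i + 1) ^ 2; omega, by show 9 * (i + 1) ^ 2 ≤ _; omega⟩
  · rw [Finset.sum_range_succ']
    have h1 := Finset.abs_sum_le_sum_abs u (Finset.range D)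
    have h2 := abs_sub (1 : ℝ) (∑ i ∈ Finset.range D, u i)
    rw [abs_one] at h2
    show ∑ i ∈ Finset.range D, |u i| + |1 - ∑ i ∈ Finset.range D, u i| ≤ 2
    linarith
  · rw [Finset.sum_range_succ', hp p hpD]
    simp only [mul_sub, Finset.sum_sub_distrib, ← Finset.sum_mul]
    show _ = ∑ i ∈ Finset.range D, u i * p.eval ((9 * (i + 1) ^ 2 : ℕ) : ℝ) +
      (1 - ∑ i ∈ Finset.range D, u i) * p.eval ((1 : ℕ) : ℝ)
    push_cast
    ring

/-- Iterating an extrapolation functional: `M` blocks raise the exactness degree `M`-fold. -/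
theorem abs_eval_zero_le_of_functional {ι : Type*} {s : Finset ι} {v : ι → ℝ} {ν : ι → ℕ}
    {K e : ℕ} (hν : ∀ i ∈ s, 1 ≤ ν i ∧ ν i ≤ K) (hv : ∑ i ∈ s, |v i| ≤ 2)
    (hex : ∀ p : Polynomial ℝ, p.natDegree < e → p.eval 0 = ∑ i ∈ s, v i * p.eval (ν i : ℝ))
    (he : 0 < e) (M : ℕ) (p : Polynomial ℝ) (B : ℝ) (hp : p.degree < ((M * e : ℕ) : WithBot ℕ))
    (hB : ∀ i : ℕ, 1 ≤ i → i ≤ K * M → |p.eval (i : ℝ)| ≤ B) :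
    |p.eval 0| ≤ (3 ^ M - 1) * B := by
  induction M generalizing p B with
  | zero =>
    have : p = 0 := by
      ext m
      exact Polynomial.degree_lt_iff_coeff_zero _ _ |>.1 hp m (by simp)
    simp [this]
  | succ M ih =>
    have hT : ∀ t : ℕ, t ≤ K * M → |∑ i ∈ s, v i * p.eval ((ν i : ℝ) + t)| ≤ 2 * B := by
      intro t ht
      rcases s.eq_empty_or_nonempty with rfl | ⟨i₀, hi₀⟩
      · have h0 := hex 1 (by simpa using he)
        simp at h0
      have hb : ∀ i ∈ s, |v i * p.eval ((ν i : ℝ) + t)| ≤ |v i| * B := by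
        intro i hi
        rw [abs_mul]
        refine mul_le_mul_of_nonneg_left ?_ (abs_nonneg _)
        have := hB (ν i + t) (by have := (hν i hi).1; omega)
          (by have := (hν i hi).2; rw [mul_add, mul_one]; omega)
        simpa using this
      have hB0 : 0 ≤ B := (abs_nonneg _).trans (hB (ν i₀) (hν i₀ hi₀).1
        ((hν i₀ hi₀).2.trans (Nat.le_mul_of_pos_right _ (Nat.succ_pos _))))
      calc _ ≤ ∑ i ∈ s, |v i| * B := (Finset.abs_sum_le_sum_abs _ _).trans (Finset.sum_le_sum hb)
        _ = (∑ i ∈ s, |v i|) * B := by rw [Finset.sum_mul]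
        _ ≤ 2 * B := mul_le_mul_of_nonneg_right hv hB0
    set q : Polynomial ℝ := p - ∑ i ∈ s, Polynomial.C (v i) * Polynomial.taylor (ν i : ℝ) p with hq
    have hqe : ∀ t : ℝ, q.eval t = p.eval t - ∑ i ∈ s, v i * p.eval ((ν i : ℝ) + t) := by
      intro t
      simp [hq, Polynomial.eval_finsetSum, Polynomial.taylor_eval, add_comm]
    have hqd : q.degree < ((M * e : ℕ) : WithBot ℕ) := by
      rw [Polynomial.degree_lt_iff_coeff_zero]
      intro m hm
      have h1 : (Polynomial.hasseDeriv m p).natDegree < e := by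
        have h2 : p.natDegree < (M + 1) * e := by
          by_cases h0 : p = 0
          · rw [h0]; simpa using he
          · exact (Polynomial.natDegree_lt_iff_degree_lt h0).2 hp
        have h3 := Polynomial.natDegree_hasseDeriv_le p m
        rw [add_mul, one_mul] at h2
        omega
      have h2 := hex _ h1
      -- For m ≥ M * e the m-th Hasse derivative has degree below e, so exactness on it says that
      -- the m-th coefficient of `q` vanishes.
      have h3 : p.coeff m = (Polynomial.hasseDeriv m p).eval 0 := by
        rw [← Polynomial.taylor_coeff, Polynomial.taylor_zero]
      simp only [hq, Polynomial.coeff_sub, Polynomial.finsetSum_coeff, Polynomial.coeff_C_mul,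
        Polynomial.taylor_coeff]
      rw [h3, h2, sub_self]
    have hq0 := ih q (3 * B) hqd fun i hi hi' => by
      rw [hqe]
      have h1 := hB i hi (hi'.trans (Nat.mul_le_mul_left _ (Nat.le_succ M)))
      have h2 := abs_sub (p.eval (i : ℝ)) (∑ j ∈ s, v j * p.eval ((ν j : ℝ) + i))
      linarith [hT i hi']
    have h4 := hT 0 (Nat.zero_le _)
    have h5 := hqe 0
    simp only [Nat.cast_zero] at h4
    have h6 : p.eval 0 = q.eval 0 + ∑ i ∈ s, v i * p.eval ((ν i : ℝ) + 0) := by linarith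
    have h7 := abs_add_le (q.eval 0) (∑ i ∈ s, v i * p.eval ((ν i : ℝ) + 0))
    rw [← h6] at h7
    rw [pow_succ]
    linarith

/-! ### Degree lower bounds -/

/-- A certificate of the optimal value yields a univariate polynomial, in the distance from the
level `⌊q⌋`, that is large at `0`, vanishes at `1` and is bounded by `1` afterwards. -/
theorem exists_polynomial_of_mem_sosValues {n a d : ℕ} {θ : ℝ} (ha : a + 1 ≤ n) (h0 : 0 < θ)
    (h1 : θ < 1) (h : ((a + 1 : ℕ) : ℝ) ∈ sosValues n (a + θ) d) :
    ∃ p : Polynomial ℝ, p.natDegree ≤ 2 * d ∧ 1 / θ ≤ p.eval 0 ∧ p.eval 1 = 0 ∧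
      ∀ i : ℕ, 1 ≤ i → i ≤ n - a → 0 ≤ p.eval (i : ℝ) ∧ p.eval (i : ℝ) ≤ 1 := by
  obtain ⟨s₀, s₁, hs⟩ := h
  have hid : ∀ S : Finset (Fin n), 0 ≤ eval (cubePoint S) s₀ ∧ 0 ≤ eval (cubePoint S) s₁ ∧
      (S.card : ℝ) - (a + 1) =
        eval (cubePoint S) s₀ + eval (cubePoint S) s₁ * (S.card - (a + θ)) := by
    intro S
    refine ⟨eval_nonneg_of_isSumSq hs.sos₀ _, eval_nonneg_of_isSumSq hs.sos₁ _, ?_⟩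
    simpa [hammingWt_cubePoint] using hs.identity _ (cubePoint_mem S)
  obtain ⟨P, hPd, hP⟩ := exists_polynomial_eval_eq_average s₁
  have hlow : ∀ (j : ℕ) (b : ℝ), j ≤ n →
      (∀ S : Finset (Fin n), S.card = j → b ≤ eval (cubePoint S) s₁) → b ≤ P.eval (j : ℝ) := by
    intro j b hj hb
    rw [hP j hj, le_div_iff₀ (by exact_mod_cast Nat.choose_pos hj)]
    have := Finset.card_nsmul_le_sum ((Finset.univ : Finset (Fin n)).powersetCard j)
      (fun S => eval (cubePoint S) s₁) b fun S hS => hb S (Finset.mem_powersetCard.1 hS).2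
    simpa [mul_comm] using this
  have hupp : ∀ (j : ℕ) (b : ℝ), j ≤ n →
      (∀ S : Finset (Fin n), S.card = j → eval (cubePoint S) s₁ ≤ b) → P.eval (j : ℝ) ≤ b := by
    intro j b hj hb
    rw [hP j hj, div_le_iff₀ (by exact_mod_cast Nat.choose_pos hj)]
    have := Finset.sum_le_card_nsmul ((Finset.univ : Finset (Fin n)).powersetCard j)
      (fun S => eval (cubePoint S) s₁) b fun S hS => hb S (Finset.mem_powersetCard.1 hS).2
    simpa [mul_comm] using this
  have hone : P.eval ((a + 1 : ℕ) : ℝ) ≤ 0 := by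
    refine hupp _ _ ha fun S hS => ?_
    obtain ⟨h2, h3, h4⟩ := hid S
    rw [hS] at h4
    push_cast at h4
    nlinarith
  have hnn : ∀ j : ℕ, j ≤ n → 0 ≤ P.eval (j : ℝ) := fun j hj =>
    hlow j 0 hj fun S _ => (hid S).2.1
  refine ⟨Polynomial.taylor (a : ℝ) P, ?_, ?_, ?_, fun i hi hin => ?_⟩
  · rw [Polynomial.natDegree_taylor]
    exact hPd.trans hs.degree₁
  · rw [Polynomial.taylor_eval, zero_add]
    refine hlow _ _ (by omega) fun S hS => ?_
    obtain ⟨h2, h3, h4⟩ := hid S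
    rw [hS] at h4
    rw [div_le_iff₀ h0]
    linarith
  · rw [Polynomial.taylor_eval]
    have h2 := hnn _ ha
    push_cast at h2 hone
    rw [add_comm]
    exact le_antisymm hone h2
  · rw [Polynomial.taylor_eval, ← Nat.cast_add]
    refine ⟨hnn _ (by omega), hupp _ _ (by omega) fun S hS => ?_⟩
    obtain ⟨h2, h3, h4⟩ := hid S
    have hi' : (1 : ℝ) ≤ i := by exact_mod_cast hi
    rw [hS] at h4
    push_cast at h4
    by_contra hc
    push Not at hc
    nlinarith [mul_pos (sub_pos.2 hc) (show (0 : ℝ) < i - θ by linarith)]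

/-- A polynomial vanishing at `1`, bounded by `1` on `1, …, N` and larger than `1 / 2` at `0` has
degree at least of order `√N`. -/
theorem lt_nine_mul_sq_of_half_lt_eval_zero {p : Polynomial ℝ} {D N : ℕ} (hd : p.natDegree ≤ D)
    (h0 : 1 / 2 < p.eval 0) (h1 : p.eval 1 = 0)
    (hb : ∀ i : ℕ, 1 ≤ i → i ≤ N → |p.eval (i : ℝ)| ≤ 1) : N < 9 * D ^ 2 := by
  by_contra! hN
  obtain ⟨u, hu, hp⟩ := exists_extrapolation_weights D
  have h2 := hp p hd
  rw [h1, zero_add] at h2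
  have h3 : ∑ i ∈ Finset.range D, u i * (p.eval (9 * ((i : ℝ) + 1) ^ 2) - 0) ≤
      ∑ i ∈ Finset.range D, |u i| := by
    refine Finset.sum_le_sum fun i hi => ?_
    have h4 : (i + 1) ^ 2 ≤ D ^ 2 := Nat.pow_le_pow_left (Finset.mem_range.1 hi) 2
    have h5 : 1 ≤ (i + 1) ^ 2 := Nat.one_le_pow _ _ (by omega)
    have h6 := hb (9 * (i + 1) ^ 2) (by omega) (by omega)
    push_cast at h6
    rw [sub_zero]
    refine (le_abs_self _).trans ?_
    rw [abs_mul]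
    exact mul_le_of_le_one_right (abs_nonneg _) h6
  linarith

/-- A polynomial of degree less than `M * (D + 1)` that is bounded by `1` on `1, …, 9 * D ^ 2 * M`
is less than `3 ^ M` at `0`. -/
theorem abs_eval_zero_lt_three_pow {p : Polynomial ℝ} {M D N : ℕ} (hD : 1 ≤ D)
    (hN : 9 * D ^ 2 * M ≤ N) (hd : p.natDegree < M * (D + 1))
    (hb : ∀ i : ℕ, 1 ≤ i → i ≤ N → |p.eval (i : ℝ)| ≤ 1) : |p.eval 0| < 3 ^ M := by
  obtain ⟨v, ν, hν, hv, hp⟩ := exists_extrapolation_functional hD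
  have := abs_eval_zero_le_of_functional hν hv (fun p hp' => hp p (Nat.lt_succ_iff.1 hp'))
    (Nat.succ_pos D) M p 1
    ((Polynomial.degree_le_natDegree).trans_lt (by exact_mod_cast hd))
    fun i hi hi' => hb i hi (hi'.trans hN)
  linarith

/-- Choosing the number `M` of blocks and their exactness degree `D`. -/
theorem min_le_of_forall_blocks {n N d : ℕ} {θ : ℝ} (hθ : 0 < θ) (hn : n ≤ 2 * N) (hd : 1 ≤ d)
    (hNd : N < 36 * d ^ 2)
    (h : ∀ M D : ℕ, 1 ≤ D → 9 * D ^ 2 * M ≤ N → 2 * d < M * (D + 1) → 1 / θ < 3 ^ M) :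
    1 / 100 * min (n : ℝ) (√(n * Real.log (1 / θ))) ≤ d := by
  have hd' : (1 : ℝ) ≤ d := by exact_mod_cast hd
  have hn' : (n : ℝ) ≤ 2 * N := by exact_mod_cast hn
  have hNd' : (N : ℝ) < 36 * d ^ 2 := by exact_mod_cast hNd
  suffices hs : (n : ℝ) ≤ 100 * d ∨ n * Real.log (1 / θ) ≤ (100 * d) ^ 2 by
    rcases hs with hs | hs
    · linarith [min_le_left (n : ℝ) (√(n * Real.log (1 / θ)))]
    · have := Real.sqrt_le_sqrt hs
      rw [Real.sqrt_sq (by positivity)] at this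
      linarith [min_le_right (n : ℝ) (√(n * Real.log (1 / θ)))]
  set L := Real.log (1 / θ) with hL
  rcases lt_or_ge L 2 with hL2 | hL2
  · right
    nlinarith [mul_le_mul_of_nonneg_left hL2.le (Nat.cast_nonneg (α := ℝ) n)]
  rcases lt_or_ge N 9 with hN9 | hN9
  · left
    have : (N : ℝ) < 9 := by exact_mod_cast hN9
    linarith
  -- The first bound gives 3^M ≤ e^(2M) ≤ 1/θ, contradicting `h` unless M(D + 1) ≤ 2d; the second
  -- keeps D ≥ 1.
  obtain ⟨M, hM⟩ : ∃ M, M = min ⌊L / 2⌋₊ (N / 9) := ⟨_, rfl⟩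
  have hf : 1 ≤ ⌊L / 2⌋₊ := Nat.le_floor (by push_cast; linarith)
  have hM1 : 1 ≤ M := by omega
  have hM9 : 9 * M ≤ N := by omega
  have hML : (M : ℝ) ≤ L / 2 :=
    (Nat.cast_le.2 (by omega : M ≤ ⌊L / 2⌋₊)).trans (Nat.floor_le (by linarith))
  have h3 : (3 : ℝ) ^ M ≤ 1 / θ := by
    calc (3 : ℝ) ^ M ≤ Real.exp 2 ^ M :=
          pow_le_pow_left₀ (by norm_num) (by linarith [Real.add_one_le_exp (2 : ℝ)]) M
      _ = Real.exp (M * 2) := (Real.exp_nat_mul 2 M).symm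
      _ ≤ Real.exp L := Real.exp_le_exp.2 (by linarith)
      _ = 1 / θ := Real.exp_log (by positivity)
  obtain ⟨D, hD⟩ : ∃ D, D = Nat.sqrt (N / (9 * M)) := ⟨_, rfl⟩
  have hD1 : 1 ≤ D := by
    rw [hD]
    exact Nat.sqrt_pos.2 (Nat.div_pos hM9 (by omega))
  have hD2 : 9 * D ^ 2 * M ≤ N := by
    have h4 : D ^ 2 ≤ N / (9 * M) := hD ▸ Nat.sqrt_le' _
    calc 9 * D ^ 2 * M = D ^ 2 * (9 * M) := by ring
      _ ≤ N / (9 * M) * (9 * M) := Nat.mul_le_mul_right _ h4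
      _ ≤ N := Nat.div_mul_le_self _ _
  have hD3 : N ≤ (D + 1) ^ 2 * (9 * M) := by
    have h4 : N / (9 * M) < (D + 1) ^ 2 := hD ▸ Nat.lt_succ_sqrt' _
    exact ((Nat.div_lt_iff_lt_mul (by omega)).1 h4).le
  have hdM : M * (D + 1) ≤ 2 * d := by
    by_contra! hc
    exact absurd (h M D hD1 hD2 hc) (not_lt.2 h3)
  have hNM : N * M ≤ 36 * d ^ 2 := by
    calc N * M ≤ (D + 1) ^ 2 * (9 * M) * M := Nat.mul_le_mul_right _ hD3
      _ = 9 * (M * (D + 1)) ^ 2 := by ring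
      _ ≤ 9 * (2 * d) ^ 2 := Nat.mul_le_mul_left _ (Nat.pow_le_pow_left hdM 2)
      _ = 36 * d ^ 2 := by ring
  have hNM' : (N : ℝ) * M ≤ 36 * d ^ 2 := by exact_mod_cast hNM
  have hN0 : (0 : ℝ) ≤ N := Nat.cast_nonneg N
  -- The active term of the minimum decides the bound: M ~ L/2 gives √(nL), M ~ N/9 gives n.
  rcases le_total ⌊L / 2⌋₊ (N / 9) with hc | hc
  · right
    have hMf : M = ⌊L / 2⌋₊ := by omega
    have h4 : L / 2 < M + 1 := hMf ▸ Nat.lt_floor_add_one (L / 2)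
    have h5 : (1 : ℝ) ≤ M := by exact_mod_cast hM1
    have h6 : L ≤ 4 * M := by linarith
    have h7 : n * L ≤ 2 * N * (4 * M) := mul_le_mul hn' h6 (by linarith) (by linarith)
    nlinarith
  · left
    have h4 : N ≤ 18 * M := by omega
    have h5 : (N : ℝ) ≤ 18 * M := by exact_mod_cast h4
    have h6 : (N : ℝ) ^ 2 ≤ (26 * d) ^ 2 := by nlinarith
    have h7 := abs_le_of_sq_le_sq h6 (by linarith)
    linarith [le_abs_self (N : ℝ)]

/-! ### The rank bound -/

theorem mainTheorem3 :
    ∃ c : ℝ, 0 < c ∧ ∀ (n : ℕ) (q : ℝ), 0 < q → q < (⌊(n : ℝ) / 2⌋ : ℝ) → Int.fract q ≠ 0 →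
      (Int.fract q ≤ 1 / 2 →
        c * min (n : ℝ) (√(n * Real.log (1 / Int.fract q))) ≤ (sosRank n q : ℝ)) ∧
      (1 / 2 < Int.fract q →
        c * √(n * (1 - Int.fract q)) ≤ (sosRank n q : ℝ)) := by
  refine ⟨1 / 100, by norm_num, fun n q hq hqn hfr => ?_⟩
  obtain ⟨a, ha⟩ : ∃ a : ℕ, ⌊q⌋ = a := 
    ⟨⌊q⌋.toNat, (Int.toNat_of_nonneg (Int.floor_nonneg.2 hq.le)).symm⟩
  have hθ1 : Int.fract q < 1 := Int.fract_lt_one q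
  have hθ0 : 0 < Int.fract q := lt_of_le_of_ne (Int.fract_nonneg q) hfr.symm
  have hqa : q = a + Int.fract q := by
    have := Int.floor_add_fract q
    rw [ha] at this
    exact_mod_cast this.symm
  have han : 2 * (a + 1) ≤ n := by
    have h1 : (⌊q⌋ : ℝ) < (⌊(n : ℝ) / 2⌋ : ℝ) := (Int.floor_le q).trans_lt hqn
    have h2 : (a : ℤ) + 1 ≤ ⌊(n : ℝ) / 2⌋ := by rw [← ha]; exact_mod_cast h1
    have h3 := Int.le_floor.1 h2
    push_cast at h3
    have h4 : 2 * ((a : ℝ) + 1) ≤ n := by linarith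
    exact_mod_cast h4
  have hqn' : q ≤ n := by
    have h4 : 2 * ((a : ℝ) + 1) ≤ n := by exact_mod_cast han
    have : (0 : ℝ) ≤ a := Nat.cast_nonneg a
    linarith
  have hceil : ⌈q⌉₊ = a + 1 := by
    rw [Nat.ceil_eq_iff (by omega)]
    push_cast
    constructor <;> linarith
  -- Exactness at degree n makes the set nonempty, so its `sInf` is attained and is not the default
  -- 0.
  obtain ⟨v, hv, hg, -⟩ : SOSExact n q (sosRank n q) :=
    Nat.sInf_mem (s := {d | SOSExact n q d}) ⟨n, sosExact_self hqn'⟩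
  have hv' : v = ((a + 1 : ℕ) : ℝ) := by
    rw [← hceil]
    exact hv.unique (isMKOptimum_ceil hqn')
  rw [hv'] at hg
  generalize sosRank n q = d at hg ⊢
  generalize Int.fract q = θ at *
  subst hqa
  obtain ⟨p, hpd, hp0, hp1, hpb⟩ :=
    exists_polynomial_of_mem_sosValues (by omega) hθ0 hθ1 hg
  have hpb' : ∀ i : ℕ, 1 ≤ i → i ≤ n - a → |p.eval (i : ℝ)| ≤ 1 := fun i hi hi' =>
    abs_le.2 ⟨by linarith [(hpb i hi hi').1], (hpb i hi hi').2⟩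
  have h1θ : 1 < 1 / θ := by rw [lt_div_iff₀ hθ0]; linarith
  have hN : n - a < 36 * d ^ 2 := by
    have := lt_nine_mul_sq_of_half_lt_eval_zero hpd (by linarith) hp1 hpb'
    rw [mul_pow] at this
    omega
  have hd : 1 ≤ d := by
    rcases Nat.eq_zero_or_pos d with rfl | h
    · simp at hN
    · exact h
  refine ⟨fun _ => min_le_of_forall_blocks hθ0 (by omega : n ≤ 2 * (n - a)) hd hN
    fun M D hD hND hdM => ?_, fun _ => ?_⟩
  · exact (hp0.trans (le_abs_self _)).trans_lt
      (abs_eval_zero_lt_three_pow hD hND (hpd.trans_lt hdM) hpb')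
  · have hn : n ≤ 72 * d ^ 2 := by omega
    have hn' : (n : ℝ) ≤ 72 * d ^ 2 := by exact_mod_cast hn
    have h2 : √(n * (1 - θ)) ≤ 100 * d := by
      refine Real.sqrt_le_iff.2 ⟨by positivity, ?_⟩
      nlinarith [mul_nonneg (Nat.cast_nonneg (α := ℝ) n) hθ0.le]
    linarith
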